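/- Let $I\subseteq\mathbb R$ be an open interval containing $0$ (possibly $I=\mathbb R$) and let $g$ be a real-analytic function on $I$ with $g(0)=0$, $g'(0)=1$, so that near $0$ $$g(x)=x+\sum_{n\ge 2}a_nx^n .$$ Let $$G(x)=\int_0^x g(\xi)\,d\xi$$ be the potential of the equation $\ddot x+g(x)=0$, so that near $0$ one has $G(x)=\frac12x^2+\sum_{n\ge 3}\frac{a_{n-1}}{n}x^n$. Write $$G(x)=\tfrac12x^2+G_1(x)+G_2(x),$$ with $G_1$ odd and $G_2$ even, for $x\in I\cap(-I)$. The origin is called an isochronous center, and $G$ an isochronous potential, if there is a number $T>0$ such that every orbit of the planar system $\dot x=y$, $\dot y=-g(x)$ through a point of some punctured neighbourhood of $(0,0)$ is periodic with minimal period $T$. (i) For every $k\ge 1$ there is a polynomial $f_k$ in $k$ variables with rational coefficients, not depending on $g$, such that for every $g$ as above for which the origin is an isochronous center $$a_{2k+1}=f_k(a_2,a_4,\dots,a_{2k}).$$ For example, $a_3=\frac{10}{9}a_2^2$. (ii) If the origin is an isochronous center, then $G_2\equiv 0$ if and only if $G_1\equiv 0$, and this holds if and only if $G(x)=\frac12x^2$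 on $I$, i.e. the potential is harmonic. -/

import Mathlib

open scoped Topology

noncomputable section

namespace Isochronous

/-- The data of the equation `x'' + g(x) = 0` on an open interval `I` around `0` (the whole line is
allowed): `g` is real analytic on `I`, normalized by `g(0) = 0` and `g'(0) = 1`, and
`g(x) = x + a₂ x² + a₃ x³ + ⋯` near `0`. Values of `g` outside `I` play no role. -/
structure IsAnalyticForce (I : Set ℝ) (g : ℝ → ℝ) (a : ℕ → ℝ) : Prop where
  isOpen : IsOpen I
  ordConnected : I.OrdConnected
  zero_mem : (0 : ℝ) ∈ I
  analytic : AnalyticOnNhd ℝ g I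
  hasSum : ∀ᶠ x in 𝓝 (0 : ℝ), HasSum (fun n : ℕ => a n * x ^ n) (g x)
  coeff_zero : a 0 = 0
  coeff_one : a 1 = 1

/-- `γ = (x, y)` is a solution, defined for all times and with `x` in `I`, of the planar system
`x' = y`, `y' = -g(x)`. -/
def IsSolution (I : Set ℝ) (g : ℝ → ℝ) (γ : ℝ → ℝ × ℝ) : Prop :=
  ∀ t : ℝ, (γ t).1 ∈ I ∧ HasDerivAt γ ((γ t).2, -g (γ t).1) t

/-- `T` is the minimal (positive) period of the curve `γ`. -/
def IsMinimalPeriod (γ : ℝ → ℝ × ℝ) (T : ℝ) : Prop :=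
  0 < T ∧ Function.Periodic γ T ∧ ∀ s : ℝ, 0 < s → s < T → ¬ Function.Periodic γ s

/-- The origin is an isochronous center of `x' = y`, `y' = -g(x)`: all orbits through points close
to the origin, other than the origin itself, are periodic with one and the same minimal period. -/
def IsIsochronousCenter (I : Set ℝ) (g : ℝ → ℝ) : Prop :=
  ∃ T : ℝ, ∀ᶠ p in 𝓝[≠] (0 : ℝ × ℝ),
    ∃ γ : ℝ → ℝ × ℝ, IsSolution I g γ ∧ γ 0 = p ∧ IsMinimalPeriod γ T

/-- The potential `G(x) = ∫₀ˣ g(ξ) dξ`. -/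
def potential (g : ℝ → ℝ) (x : ℝ) : ℝ := ∫ ξ in (0 : ℝ)..x, g ξ

/-- The odd function `G₁` in the decomposition `G(x) = x²/2 + G₁(x) + G₂(x)`. -/
def oddTerm (g : ℝ → ℝ) (x : ℝ) : ℝ := (potential g x - potential g (-x)) / 2

/-- The even function `G₂` in the decomposition `G(x) = x²/2 + G₁(x) + G₂(x)`. -/
def evenTerm (g : ℝ → ℝ) (x : ℝ) : ℝ := (potential g x + potential g (-x)) / 2 - x ^ 2 / 2

/-- The points where both `G(x)` and `G(-x)` are defined, the common domain of `G₁` and `G₂`. -/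
def symmetricDomain (I : Set ℝ) : Set ℝ := {x | x ∈ I ∧ -x ∈ I}

end Isochronous

end

/-!
Near `0` write `2G(x) = s(x)²` with an analytic coordinate `s(x) = x + ⋯`, and let `h` be the
inverse function of `s`. Differentiating `G(h(u)) = u²/2` gives `g(h(u)) h'(u) = u`, so the orbit through
`(0, A)` is `(h(A sin θ), A cos θ)` with `θ' = 1 / h'(A sin θ)`, and its minimal period is
`∫₀^{2π} h'(A sin φ) dφ` (`exists_isSolution_isMinimalPeriod`). Expanding in powers of `A`, the
coefficient of `A²ʲ` is that of `h'` times the positive number `∫ sin²ʲ`. Isochronicity therefore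
means that `h'` is `1` plus an odd function, that is `h(u) = u + E(u²)` for a power series
`E(w) = ∑ eⱼ wʲ`, `e₀ = 0`. Substituting `u = s(x)` yields

  `2G = (x - E(2G))²`,

an identity of formal power series (`FormalRelation`), from which both parts of the theorem are
read off.

*Universal polynomials.* Comparing coefficients, the coefficient of `x^{2k+1}` in `2G`
and the earlier ones determine `e_k`, and the coefficient of `x^{2k+2}` is then a rational polynomial in what is already
known (`FormalRelation.coeff_mem`). Uniformity in `g` comes for free by running the recursion in the
ring of real functions on the set of all solutions of the relation, where "is a universal rational
polynomial in" means "lies in the subalgebra generated by" (`exists_universal_polynomial`).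

*Harmonic potentials.* If `e_m` is the first nonzero coefficient of `E`, then the coefficient of
`x^{2m+1}` in `2G` is `-2 e_m` and that of `x^{4m}` is `(4m + 1) e_m²`
(`FormalRelation.coeff_of_forall_lt`). Hence `G₁ ≡ 0`, and likewise `G₂ ≡ 0`, forces `E = 0`, that
is `2G = x²` near `0`, and then on all of `I` by the identity theorem. For `m = 1` the same formulas
give `a₃ = (10/9) a₂²`.
-/

namespace Isochronous

/-! ### The formal relation between the coefficients -/

open PowerSeries in
/-- `W = E(F)` and `F = (x - W)²` as formal power series, where `F = x² Q` and
`E(w) = ∑ eⱼ wʲ`; the identity `W = E(F)` is expressed modulo every even power of `x`.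
For an isochronous potential these hold with `F = 2G`. -/
structure FormalRelation {R : Type*} [CommRing R] (Q W : PowerSeries R) (e : ℕ → R) : Prop where
  coeff_zero : coeff 0 Q = 1
  e_zero : e 0 = 0
  dvd : ∀ N : ℕ, (X : PowerSeries R) ^ (2 * N) ∣
    W - ∑ j ∈ Finset.range N, C (e j) * ((X : PowerSeries R) ^ 2 * Q) ^ j
  eq_sq : (X : PowerSeries R) ^ 2 * Q = (X - W) ^ 2

section Formal

open PowerSeries

variable {R : Type*} [CommRing R]

theorem coeff_pow_mem {K : Type*} [CommRing K] [Algebra K R] (S : Subalgebra K R)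
    {Q : PowerSeries R} {m : ℕ} (hQ : ∀ i ≤ m, coeff i Q ∈ S) (j : ℕ) :
    ∀ i ≤ m, coeff i (Q ^ j) ∈ S := by
  induction j with
  | zero =>
    intro i _
    rw [pow_zero, coeff_one]
    split_ifs
    exacts [S.one_mem, S.zero_mem]
  | succ j ih =>
    intro i hi
    rw [pow_succ, coeff_mul]
    refine S.sum_mem fun p hp => ?_
    have := Finset.HasAntidiagonal.mem_antidiagonal.1 hp
    exact S.mul_mem (ih _ (by omega)) (hQ _ (by omega))

namespace FormalRelation

variable {Q W : PowerSeries R} {e : ℕ → R}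

theorem coeff_W (h : FormalRelation Q W e) (n : ℕ) :
    coeff n W = ∑ j ∈ Finset.range (n / 2 + 1), e j * coeff (n - 2 * j) (Q ^ j) := by
  have h1 := X_pow_dvd_iff.1 (h.dvd (n / 2 + 1)) n (by omega)
  rw [map_sub, sub_eq_zero] at h1
  rw [h1, map_sum]
  refine Finset.sum_congr rfl fun j hj => ?_
  have := Finset.mem_range.1 hj
  rw [coeff_C_mul, mul_pow, ← pow_mul, coeff_X_pow_mul', if_pos (by omega)]

theorem coeff_W_zero (h : FormalRelation Q W e) : coeff 0 W = 0 := by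
  rw [h.coeff_W]; simp [h.e_zero]

theorem coeff_W_one (h : FormalRelation Q W e) : coeff 1 W = 0 := by
  rw [h.coeff_W]; simp [h.e_zero]

theorem coeff_Q (h : FormalRelation Q W e) (m : ℕ) :
    coeff (m + 1) Q = -2 * coeff (m + 2) W + coeff (m + 3) (W ^ 2) := by
  have h1 := congrArg (coeff (m + 3)) h.eq_sq
  have h2 : (X - W) ^ 2 = X ^ 2 - C (2 : R) * (X * W) + W ^ 2 := by
    rw [map_ofNat]; ring
  rw [h2, coeff_X_pow_mul', if_pos (by omega), map_add, map_sub, coeff_C_mul, coeff_X_pow,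
    if_neg (by omega), show m + 3 = (m + 2) + 1 from rfl, coeff_succ_X_mul] at h1
  rw [show m + 1 = m + 2 + 1 - 2 by omega, h1]
  ring

theorem coeff_W_sq_mem {K : Type*} [CommRing K] [Algebra K R] (S : Subalgebra K R)
    (h : FormalRelation Q W e) {m : ℕ} (hW : ∀ i ≤ m + 1, coeff i W ∈ S) :
    coeff (m + 3) (W ^ 2) ∈ S := by
  rw [pow_two, coeff_mul]
  refine S.sum_mem fun p hp => ?_
  have hp' := Finset.HasAntidiagonal.mem_antidiagonal.1 hp
  -- the terms with an index `0` or `1` vanish, so that both indices are at most `m + 1`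
  rcases Nat.lt_or_ge (m + 1) p.1 with h1 | h1
  · have : p.2 = 0 ∨ p.2 = 1 := by omega
    rcases this with h2 | h2 <;> rw [h2] <;> simp [h.coeff_W_zero, h.coeff_W_one]
  rcases Nat.lt_or_ge (m + 1) p.2 with h2 | h2
  · have : p.1 = 0 ∨ p.1 = 1 := by omega
    rcases this with h2 | h2 <;> rw [h2] <;> simp [h.coeff_W_zero, h.coeff_W_one]
  exact S.mul_mem (hW _ h1) (hW _ h2)

/-- The coefficients of odd index of `Q` determine the first `E`-coefficients and the coefficients
of even index, by the recursion that `F = (x - E(F))²` gives. -/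
theorem coeff_mem [Algebra ℚ R] (S : Subalgebra ℚ R) (h : FormalRelation Q W e) {k : ℕ}
    (hS : ∀ j < k, coeff (2 * j + 1) Q ∈ S) (m : ℕ) (hm : m ≤ 2 * k) :
    coeff m Q ∈ S ∧ ∀ j, 2 * j ≤ m + 1 → e j ∈ S := by
  induction m using Nat.strong_induction_on with
  | _ m ih =>
    rcases m with _ | m
    · refine ⟨by rw [h.coeff_zero]; exact S.one_mem, fun j hj => ?_⟩
      rw [show j = 0 by omega, h.e_zero]
      exact S.zero_mem
    have hQ : ∀ i ≤ m, coeff i Q ∈ S := fun i hi => (ih i (by omega) (by omega)).1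
    have he : ∀ j, 2 * j ≤ m + 1 → e j ∈ S := (ih m (by omega) (by omega)).2
    have hterm : ∀ n ≤ m + 2, ∀ j, 2 * j ≤ m + 1 → e j * coeff (n - 2 * j) (Q ^ j) ∈ S := by
      intro n hn j hj
      rcases Nat.eq_zero_or_pos j with rfl | hj0
      · rw [h.e_zero, zero_mul]; exact S.zero_mem
      · exact S.mul_mem (he j hj) (coeff_pow_mem S hQ j _ (by omega))
    have hW : ∀ n ≤ m + 1, coeff n W ∈ S := by
      intro n hn
      rw [h.coeff_W]
      refine S.sum_mem fun j hj => ?_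
      have := Finset.mem_range.1 hj
      exact hterm n (by omega) j (by omega)
    have hsq := h.coeff_W_sq_mem S hW
    have hhalf : ∀ x : R, 2 * x ∈ S → x ∈ S := by
      intro x hx
      have h1 := S.smul_mem hx (1 / 2 : ℚ)
      have h2 : (1 / 2 : ℚ) • (2 * x) = x := by
        rw [two_mul, ← two_smul ℚ x, smul_smul]; norm_num
      rwa [h2] at h1
    rcases Nat.even_or_odd' m with ⟨j, rfl | rfl⟩
    -- odd index: the coefficient of `Q` is given, and the relation is solved for `e (j + 1)`
    · have hq := hS j (by omega)
      refine ⟨hq, fun i hi => ?_⟩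
      rcases Nat.lt_or_ge (2 * j + 1) (2 * i) with hij | hij
      swap
      · exact he i hij
      have hi' : i = j + 1 := by omega
      subst hi'
      have hw : coeff (2 * j + 2) W ∈ S := by
        apply hhalf
        have : 2 * coeff (2 * j + 2) W = coeff (2 * j + 3) (W ^ 2) - coeff (2 * j + 1) Q := by
          rw [h.coeff_Q]; ring
        rw [this]
        exact S.sub_mem hsq hq
      have h1 := h.coeff_W (2 * j + 2)
      rw [show (2 * j + 2) / 2 + 1 = (j + 1) + 1 by omega, Finset.sum_range_succ,
        show 2 * j + 2 - 2 * (j + 1) = 0 by omega, coeff_zero_eq_constantCoeff_apply, map_pow,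
        ← coeff_zero_eq_constantCoeff_apply, h.coeff_zero, one_pow, mul_one] at h1
      rw [← sub_eq_iff_eq_add'.2 h1]
      refine S.sub_mem hw (S.sum_mem fun i hi => ?_)
      have := Finset.mem_range.1 hi
      exact hterm _ le_rfl i (by omega)
    -- even index: no new `e` enters, and the relation gives the coefficient of `Q`
    · have hw : coeff (2 * j + 1 + 2) W ∈ S := by
        rw [h.coeff_W]
        refine S.sum_mem fun i hi => ?_
        have := Finset.mem_range.1 hi
        exact hterm _ le_rfl i (by omega)
      refine ⟨?_, fun i hi => he i (by omega)⟩
      rw [h.coeff_Q]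
      refine S.add_mem ?_ hsq
      rw [neg_mul, two_mul]
      exact S.neg_mem (S.add_mem hw hw)

/-- If `E(w) = eₘ wᵐ + ⋯`, then the first nonlinear terms of `F` of odd and of even degree have
coefficients `-2 eₘ` and `(4m + 1) eₘ²`. -/
theorem coeff_of_forall_lt (h : FormalRelation Q W e) {m : ℕ} (hm : 1 ≤ m)
    (he : ∀ i < m, e i = 0) :
    coeff (2 * m - 1) Q = -2 * e m ∧ coeff (4 * m - 2) Q = (4 * m + 1) * e m ^ 2 := by
  obtain ⟨l, rfl⟩ : ∃ l, m = l + 1 := ⟨m - 1, by omega⟩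
  have hWlow : ∀ n < 2 * (l + 1), coeff n W = 0 := by
    intro n hn
    rw [h.coeff_W]
    refine Finset.sum_eq_zero fun j hj => ?_
    have := Finset.mem_range.1 hj
    rw [he j (by omega), zero_mul]
  obtain ⟨U, hU⟩ := X_pow_dvd_iff.2 hWlow
  have hU0 : coeff 0 U = e (l + 1) := by
    have h1 : coeff (2 * (l + 1)) W = coeff 0 U := by
      rw [hU, coeff_X_pow_mul', if_pos le_rfl, Nat.sub_self]
    rw [← h1, h.coeff_W, show 2 * (l + 1) / 2 + 1 = (l + 1) + 1 by omega, Finset.sum_range_succ,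
      Finset.sum_eq_zero, zero_add, Nat.sub_self, coeff_zero_eq_constantCoeff_apply, map_pow,
      ← coeff_zero_eq_constantCoeff_apply, h.coeff_zero, one_pow, mul_one]
    intro j hj
    rw [he j (Finset.mem_range.1 hj), zero_mul]
  -- the next coefficients of `Q` after the constant one
  have hWsq : W ^ 2 = X ^ (4 * l + 4) * U ^ 2 := by rw [hU]; ring
  have hQ1 : ∀ i ≤ 2 * l, coeff (i + 1) Q = if i = 2 * l then -2 * e (l + 1) else 0 := by
    intro i h1
    split_ifs with h2
    · rw [h.coeff_Q, hWsq, coeff_X_pow_mul', if_neg (by omega), hU, coeff_X_pow_mul',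
        if_pos (by omega), show i + 2 - 2 * (l + 1) = 0 by omega, hU0, add_zero]
    · rw [h.coeff_Q, hWsq, coeff_X_pow_mul', if_neg (by omega), hWlow _ (by omega)]
      simp
  have hQV : ∃ V, Q = 1 + X ^ (2 * l + 1) * V ∧ coeff 0 V = -2 * e (l + 1) := by
    have : (X : PowerSeries R) ^ (2 * l + 1) ∣ Q - 1 := by
      refine X_pow_dvd_iff.2 fun i hi => ?_
      rcases i with _ | i
      · rw [map_sub, h.coeff_zero, coeff_one, if_pos rfl, sub_self]
      · rw [map_sub, hQ1 i (by omega), if_neg (by omega), coeff_one, if_neg (by omega),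
          sub_zero]
    obtain ⟨V, hV⟩ := this
    have hQV : Q = 1 + X ^ (2 * l + 1) * V := by rw [← hV]; ring
    refine ⟨V, hQV, ?_⟩
    have h1 := hQ1 (2 * l) le_rfl
    rw [if_pos rfl] at h1
    rw [← h1]
    nth_rewrite 1 [hQV]
    rw [map_add, coeff_one, if_neg (by omega), coeff_X_pow_mul', if_pos le_rfl, Nat.sub_self,
      zero_add]
  obtain ⟨V, hQV, hV0⟩ := hQV
  have hpow : ∀ j : ℕ, ∃ Y,
      Q ^ j = 1 + C (j : R) * (X ^ (2 * l + 1) * V) + X ^ (4 * l + 2) * Y := by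
    intro j
    induction j with
    | zero => exact ⟨0, by simp⟩
    | succ j ih =>
      obtain ⟨Y, hY⟩ := ih
      refine ⟨Y + C (j : R) * V ^ 2 + Y * (X ^ (2 * l + 1) * V), ?_⟩
      rw [pow_succ, hY, hQV, Nat.cast_succ, map_add, map_one]
      ring
  -- Only `j = m` contributes in degree `4m - 1`, where `m = l + 1`: for `j > m` the index
  -- `4m - 1 - 2j` is odd, hence nonzero, and less than `2m - 1`, so that coefficient of `Qʲ` vanishes.
  have hWodd : coeff (4 * l + 3) W = -2 * (l + 1) * e (l + 1) ^ 2 := by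
    rw [h.coeff_W, Finset.sum_eq_single (l + 1)]
    · obtain ⟨Y, hY⟩ := hpow (l + 1)
      rw [show 4 * l + 3 - 2 * (l + 1) = 2 * l + 1 by omega, hY, map_add, map_add, coeff_C_mul,
        coeff_one, if_neg (by omega), coeff_X_pow_mul', if_pos le_rfl, Nat.sub_self, hV0,
        coeff_X_pow_mul', if_neg (by omega)]
      push_cast
      ring
    · intro j hj hne
      have hj' := Finset.mem_range.1 hj
      rcases Nat.lt_or_ge j (l + 1) with h1 | h1
      · rw [he j h1, zero_mul]
      · obtain ⟨Y, hY⟩ := hpow j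
        rw [hY, map_add, map_add, coeff_C_mul, coeff_one, if_neg (by omega), coeff_X_pow_mul',
          if_neg (by omega), coeff_X_pow_mul', if_neg (by omega)]
        simp
    · intro hl
      exact absurd (Finset.mem_range.2 (by omega)) hl
  constructor
  · have h1 := hQ1 (2 * l) le_rfl
    rwa [if_pos rfl] at h1
  · rw [show 4 * (l + 1) - 2 = (4 * l + 1) + 1 by omega, h.coeff_Q, hWodd, hWsq, coeff_X_pow_mul',
      if_pos (by omega), show 4 * l + 1 + 3 - (4 * l + 4) = 0 by omega,
      coeff_zero_eq_constantCoeff_apply, map_pow, ← coeff_zero_eq_constantCoeff_apply, hU0]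
    push_cast
    ring

/-- If `E = 0`, then `F = x²`. -/
theorem eq_one_of_forall_eq_zero (h : FormalRelation Q W e) (he : ∀ i, e i = 0) : Q = 1 := by
  have hW : W = 0 := by
    ext n
    rw [h.coeff_W, Finset.sum_eq_zero fun j _ => by rw [he, zero_mul], map_zero]
  ext n
  rcases n with _ | n
  · rw [h.coeff_zero, coeff_one, if_pos rfl]
  · rw [h.coeff_Q, hW, coeff_one, if_neg (by omega)]
    simp

end FormalRelation

end Formal

/-! ### Universal polynomials -/

section Universal

open PowerSeries

/-- One rational polynomial computes the coefficient of index `2k` of `Q` from those of odd index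
below, for all solutions of the formal relation at once: the recursion is run in the ring of
functions on the set of all solutions. -/
theorem exists_universal_polynomial (k : ℕ) : ∃ P : MvPolynomial (Fin k) ℚ,
    ∀ (Q W : PowerSeries ℝ) (e : ℕ → ℝ), FormalRelation Q W e →
      coeff (2 * k) Q = MvPolynomial.aeval (fun i : Fin k => coeff (2 * (i : ℕ) + 1) Q) P := by
  let D := {d : PowerSeries ℝ × PowerSeries ℝ × (ℕ → ℝ) // FormalRelation d.1 d.2.1 d.2.2}
  let Q : PowerSeries (D → ℝ) := PowerSeries.mk fun n d => coeff n d.1.1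
  let W : PowerSeries (D → ℝ) := PowerSeries.mk fun n d => coeff n d.1.2.1
  let e : ℕ → D → ℝ := fun n d => d.1.2.2 n
  let φ : D → (D → ℝ) →+* ℝ := fun d => Pi.evalRingHom (fun _ => ℝ) d
  have hφ : ∀ (d : D) (n : ℕ) (p : PowerSeries (D → ℝ)), coeff n p d = coeff n (map (φ d) p) :=
    fun d n p => by rw [coeff_map]; rfl
  have hQ : ∀ d, map (φ d) Q = d.1.1 := fun d => by ext n; rw [← hφ, coeff_mk]
  have hW : ∀ d, map (φ d) W = d.1.2.1 := fun d => by ext n; rw [← hφ, coeff_mk]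
  have hrel : FormalRelation Q W e := by
    refine ⟨?_, ?_, fun N => ?_, ?_⟩
    · funext d
      rw [hφ, hQ]
      exact d.2.coeff_zero
    · funext d
      exact d.2.e_zero
    · refine X_pow_dvd_iff.2 fun n hn => ?_
      funext d
      have h1 := X_pow_dvd_iff.1 (d.2.dvd N) n hn
      rw [hφ, map_sub (map (φ d)), map_sum (map (φ d)), hW]
      simp only [map_mul, map_pow, map_C, map_X, hQ]
      exact h1
    · ext n d
      rw [hφ, hφ, map_mul, map_pow, map_pow, map_sub (map (φ d)), map_X, hQ, hW, d.2.eq_sq]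
  let q : Fin k → D → ℝ := fun i => coeff (2 * (i : ℕ) + 1) Q
  have hmem := (hrel.coeff_mem (Algebra.adjoin ℚ (Set.range q)) (k := k)
    (fun j hj => Algebra.subset_adjoin ⟨⟨j, hj⟩, rfl⟩) (2 * k) le_rfl).1
  rw [Algebra.adjoin_range_eq_range_aeval] at hmem
  obtain ⟨P, hP⟩ := hmem
  refine ⟨P, fun Q' W' e' h' => ?_⟩
  have h1 := congrFun hP ⟨(Q', W', e'), h'⟩
  have h2 : (MvPolynomial.aeval q P) ⟨(Q', W', e'), h'⟩ =
      MvPolynomial.aeval (fun i => q i ⟨(Q', W', e'), h'⟩) P := by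
    have := MvPolynomial.comp_aeval_apply q (Pi.evalAlgHom ℚ (fun _ : D => ℝ) ⟨(Q', W', e'), h'⟩) P
    exact this
  have h3 : coeff (2 * k) Q ⟨(Q', W', e'), h'⟩ = coeff (2 * k) Q' := by
    rw [hφ, hQ]
  have h4 : ∀ i, q i ⟨(Q', W', e'), h'⟩ = coeff (2 * (i : ℕ) + 1) Q' := fun i => by
    simp only [q]
    rw [hφ, hQ]
  rw [← h3, ← h1]
  refine h2.trans ?_
  simp only [h4]

end Universal

/-! ### Power series and asymptotic expansions at the origin -/

section Expansions

open Filter Asymptotics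

/-- `f` is the sum of the power series `∑ cₙ xⁿ` near `0`. -/
def IsPowerSum (f : ℝ → ℝ) (c : ℕ → ℝ) : Prop :=
  ∀ᶠ x in 𝓝 (0 : ℝ), HasSum (fun n => c n * x ^ n) (f x)

theorem IsPowerSum.hasFPowerSeriesAt {f : ℝ → ℝ} {c : ℕ → ℝ} (h : IsPowerSum f c) :
    HasFPowerSeriesAt f (FormalMultilinearSeries.ofScalars ℝ c) 0 := by
  rw [hasFPowerSeriesAt_iff']
  filter_upwards [h] with x hx
  simpa [FormalMultilinearSeries.coeff_ofScalars, mul_comm] using hx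

theorem IsPowerSum.analyticAt {f : ℝ → ℝ} {c : ℕ → ℝ} (h : IsPowerSum f c) : AnalyticAt ℝ f 0 :=
  h.hasFPowerSeriesAt.analyticAt

theorem exists_isPowerSum {f : ℝ → ℝ} (h : AnalyticAt ℝ f 0) : ∃ c, IsPowerSum f c := by
  obtain ⟨p, hp⟩ := h
  refine ⟨p.coeff, ?_⟩
  rw [hasFPowerSeriesAt_iff'] at hp
  filter_upwards [hp] with x hx
  simpa [mul_comm] using hx

theorem IsPowerSum.congr {f g : ℝ → ℝ} {c : ℕ → ℝ} (h : IsPowerSum f c) (hfg : f =ᶠ[𝓝 0] g) :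
    IsPowerSum g c := by
  filter_upwards [h, hfg] with x hx hx'
  rwa [← hx']

theorem IsPowerSum.unique {f : ℝ → ℝ} {c d : ℕ → ℝ} (hc : IsPowerSum f c) (hd : IsPowerSum f d) :
    c = d :=
  FormalMultilinearSeries.ofScalars_series_injective ℝ ℝ
    (hc.hasFPowerSeriesAt.eq_formalMultilinearSeries hd.hasFPowerSeriesAt)

theorem IsPowerSum.apply_zero {f : ℝ → ℝ} {c : ℕ → ℝ} (h : IsPowerSum f c) : f 0 = c 0 := by
  have h1 := h.self_of_nhds
  refine h1.unique ?_
  convert hasSum_single (f := fun n => c n * (0 : ℝ) ^ n) 0 ?_ using 1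
  · simp
  · intro n hn
    simp [hn]

theorem isPowerSum_single (b : ℝ) (m : ℕ) : IsPowerSum (fun x => b * x ^ m) (Pi.single m b) := by
  refine Eventually.of_forall fun x => ?_
  convert hasSum_single (f := fun n => (Pi.single m b : ℕ → ℝ) n * x ^ n) m ?_ using 1
  · simp
  · intro n hn
    simp [Pi.single_eq_of_ne hn]

theorem IsPowerSum.add {f g : ℝ → ℝ} {c d : ℕ → ℝ} (hc : IsPowerSum f c) (hd : IsPowerSum g d) :
    IsPowerSum (fun x => f x + g x) (fun n => c n + d n) := by
  filter_upwards [hc, hd] with x h1 h2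
  simpa [add_mul] using h1.add h2

theorem IsPowerSum.const_mul {f : ℝ → ℝ} {c : ℕ → ℝ} (b : ℝ) (hc : IsPowerSum f c) :
    IsPowerSum (fun x => b * f x) (fun n => b * c n) := by
  filter_upwards [hc] with x h1
  simpa [mul_assoc] using h1.mul_left b

theorem IsPowerSum.comp_neg {f : ℝ → ℝ} {c : ℕ → ℝ} (hc : IsPowerSum f c) :
    IsPowerSum (fun x => f (-x)) (fun n => (-1) ^ n * c n) := by
  have h0 : Tendsto (fun x : ℝ => -x) (𝓝 0) (𝓝 0) := by
    simpa using (continuous_neg (G := ℝ)).tendsto 0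
  filter_upwards [h0.eventually hc] with x h1
  convert h1 using 2 with n
  rw [neg_pow]
  ring

/-- Division by `x²`; the value at `0` is the constant term of the quotient. -/
theorem IsPowerSum.exists_div_sq {f : ℝ → ℝ} {c : ℕ → ℝ} (hc : IsPowerSum f c) (h0 : c 0 = 0)
    (h1 : c 1 = 0) :
    ∃ q : ℝ → ℝ, IsPowerSum q (fun n => c (n + 2)) ∧ ∀ᶠ x in 𝓝 (0 : ℝ), f x = x ^ 2 * q x := by
  have key : ∀ᶠ x in 𝓝 (0 : ℝ), HasSum (fun n => c (n + 2) * x ^ n) (∑' n, c (n + 2) * x ^ n) := by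
    filter_upwards [hc] with x hx
    refine Summable.hasSum ?_
    rcases eq_or_ne x 0 with rfl | hx0
    · refine summable_of_ne_finset_zero (s := {0}) fun n hn => ?_
      have : n ≠ 0 := by simpa using hn
      simp [this]
    · have h2 := ((summable_nat_add_iff 2).2 hx.summable).mul_left ((x ^ 2)⁻¹)
      refine h2.congr fun n => ?_
      field_simp
      ring
  refine ⟨_, key, ?_⟩
  filter_upwards [hc, key] with x hx hk
  have h2 := (hasSum_nat_add_iff' 2).2 hx
  have h3 := hk.mul_left (x ^ 2)
  have h4 : (fun n => x ^ 2 * (c (n + 2) * x ^ n)) = fun n => c (n + 2) * x ^ (n + 2) := by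
    funext n; ring
  rw [h4] at h3
  have h5 := h2.unique h3
  simpa [Finset.sum_range_succ, h0, h1] using h5

/-- Termwise integration of a power series. -/
theorem IsPowerSum.antideriv {f F : ℝ → ℝ} {c : ℕ → ℝ} (hc : IsPowerSum f c)
    (hF : ∀ᶠ x in 𝓝 (0 : ℝ), HasDerivAt F (f x) x) (hF0 : F 0 = 0) :
    IsPowerSum F (fun n => if n = 0 then 0 else c (n - 1) / n) := by
  obtain ⟨ε, hε, hball⟩ := Metric.eventually_nhds_iff_ball.1 (hc.and hF)
  have hrball : ε / 2 ∈ Metric.ball (0 : ℝ) ε := by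
    rw [mem_ball_zero_iff, Real.norm_eq_abs, abs_of_pos (by positivity)]
    linarith
  have hsum : Summable fun n => |c n * (ε / 2) ^ n| := (hball _ hrball).1.summable.abs
  have hsub : ∀ x ∈ Metric.ball (0 : ℝ) (ε / 2), x ∈ Metric.ball (0 : ℝ) ε :=
    fun x hx => Metric.ball_subset_ball (by linarith) hx
  let t : ℕ → ℝ → ℝ := fun n x => c n / (n + 1) * x ^ (n + 1)
  have hpre : IsPreconnected (Metric.ball (0 : ℝ) (ε / 2)) := (convex_ball _ _).isPreconnected
  have h0mem : (0 : ℝ) ∈ Metric.ball (0 : ℝ) (ε / 2) := Metric.mem_ball_self (by positivity)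
  have hder : ∀ n y, y ∈ Metric.ball (0 : ℝ) (ε / 2) → HasDerivAt (t n) (c n * y ^ n) y := by
    intro n y _
    have h1 := (hasDerivAt_pow (n + 1) y).const_mul (c n / (n + 1))
    refine h1.congr_deriv ?_
    have : (n : ℝ) + 1 ≠ 0 := by positivity
    push_cast
    field_simp
  have hbound : ∀ n y, y ∈ Metric.ball (0 : ℝ) (ε / 2) →
      ‖c n * y ^ n‖ ≤ |c n * (ε / 2) ^ n| := by
    intro n y hy
    rw [mem_ball_zero_iff] at hy
    rw [Real.norm_eq_abs, abs_mul, abs_mul, abs_pow, abs_pow, abs_of_pos (half_pos hε)]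
    gcongr
    exact hy.le
  have ht0 : Summable fun n => t n 0 := by
    simp [t]
  have hts : ∀ y ∈ Metric.ball (0 : ℝ) (ε / 2), Summable fun n => t n y := fun y hy =>
    summable_of_summable_hasDerivAt_of_isPreconnected hsum Metric.isOpen_ball hpre hder hbound
      h0mem ht0 hy
  have hD : ∀ y ∈ Metric.ball (0 : ℝ) (ε / 2), HasDerivAt (fun z => ∑' n, t n z) (f y) y := by
    intro y hy
    have h1 := hasDerivAt_tsum_of_isPreconnected hsum Metric.isOpen_ball hpre hder hbound h0mem
      ht0 hy
    rwa [((hball y (hsub y hy)).1).tsum_eq] at h1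
  have hEq : Set.EqOn F (fun z => ∑' n, t n z) (Metric.ball (0 : ℝ) (ε / 2)) := by
    refine Metric.isOpen_ball.eqOn_of_deriv_eq hpre
      (fun y hy => (hball y (hsub y hy)).2.differentiableAt.differentiableWithinAt)
      (fun y hy => (hD y hy).differentiableAt.differentiableWithinAt)
      (fun y hy => by rw [(hball y (hsub y hy)).2.deriv, (hD y hy).deriv]) h0mem ?_
    simp [hF0, t]
  filter_upwards [Metric.ball_mem_nhds (0 : ℝ) (half_pos hε)] with x hx
  rw [hEq hx]
  have h1 := (hts x hx).hasSum
  refine (hasSum_nat_add_iff' 1).1 ?_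
  simpa [t] using h1

/-- `p` is the asymptotic expansion of `f` at `0`, to all orders. For each `N` any polynomial that
agrees with `p` up to degree `N - 1` may serve as the approximation, which makes products
immediate. -/
def HasExpansion (f : ℝ → ℝ) (p : PowerSeries ℝ) : Prop :=
  ∀ N : ℕ, ∃ P : Polynomial ℝ, (PowerSeries.X : PowerSeries ℝ) ^ N ∣ p - (P : PowerSeries ℝ) ∧
    (fun x => f x - P.eval x) =O[𝓝 0] fun x : ℝ => x ^ N

/-- Taylor's theorem: the remainder after `N` terms is `O(x^N)`. -/
theorem IsPowerSum.isBigO {f : ℝ → ℝ} {c : ℕ → ℝ} (h : IsPowerSum f c) (N : ℕ) :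
    (fun x => f x - ∑ n ∈ Finset.range N, c n * x ^ n) =O[𝓝 0] fun x : ℝ => x ^ N := by
  have h1 := h.hasFPowerSeriesAt.isBigO_sub_partialSum_pow N
  have h2 : (fun y : ℝ => ‖y‖ ^ N) =O[𝓝 0] fun x : ℝ => x ^ N := by
    refine IsBigO.of_bound 1 (Eventually.of_forall fun x => ?_)
    simp
  refine (h1.trans h2).congr_left fun x => ?_
  simp [FormalMultilinearSeries.partialSum, mul_comm]

theorem IsPowerSum.hasExpansion {f : ℝ → ℝ} {c : ℕ → ℝ} (h : IsPowerSum f c) :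
    HasExpansion f (PowerSeries.mk c) := by
  intro N
  refine ⟨∑ n ∈ Finset.range N, Polynomial.C (c n) * Polynomial.X ^ n, ?_, ?_⟩
  · refine PowerSeries.X_pow_dvd_iff.2 fun n hn => ?_
    rw [map_sub, Polynomial.coeff_coe, Polynomial.finsetSum_coeff]
    simp [hn]
  · refine (h.isBigO N).congr_left fun x => ?_
    rw [Polynomial.eval_finsetSum]
    simp

theorem hasExpansion_polynomial (P : Polynomial ℝ) :
    HasExpansion (fun x => P.eval x) (P : PowerSeries ℝ) := by
  intro N
  refine ⟨P, by simp, ?_⟩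
  simpa using isBigO_zero _ _

theorem HasExpansion.congr {f g : ℝ → ℝ} {p : PowerSeries ℝ} (h : HasExpansion f p)
    (hfg : f =ᶠ[𝓝 0] g) : HasExpansion g p := by
  intro N
  obtain ⟨P, hP, hO⟩ := h N
  exact ⟨P, hP, hO.congr' (hfg.mono fun x hx => by simp only [hx]) EventuallyEq.rfl⟩

theorem HasExpansion.sub {f g : ℝ → ℝ} {p q : PowerSeries ℝ} (hf : HasExpansion f p)
    (hg : HasExpansion g q) : HasExpansion (fun x => f x - g x) (p - q) := by
  intro N
  obtain ⟨P, hP, hPO⟩ := hf N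
  obtain ⟨Q, hQ, hQO⟩ := hg N
  refine ⟨P - Q, ?_, ?_⟩
  · have := dvd_sub hP hQ
    rw [Polynomial.coe_sub]
    convert this using 1
    ring
  · refine (hPO.sub hQO).congr_left fun x => ?_
    rw [Polynomial.eval_sub]
    ring

theorem HasExpansion.isBigO_one {f : ℝ → ℝ} {p : PowerSeries ℝ} (hf : HasExpansion f p) :
    f =O[𝓝 0] fun _ : ℝ => (1 : ℝ) := by
  obtain ⟨P, -, hPO⟩ := hf 0
  have h1 : (fun x => P.eval x) =O[𝓝 0] fun _ : ℝ => (1 : ℝ) :=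
    (P.continuous.tendsto 0).isBigO_one ℝ
  simp only [pow_zero] at hPO
  exact (hPO.add h1).congr_left fun x => by ring

theorem HasExpansion.mul {f g : ℝ → ℝ} {p q : PowerSeries ℝ} (hf : HasExpansion f p)
    (hg : HasExpansion g q) : HasExpansion (fun x => f x * g x) (p * q) := by
  intro N
  obtain ⟨P, hP, hPO⟩ := hf N
  obtain ⟨Q, hQ, hQO⟩ := hg N
  refine ⟨P * Q, ?_, ?_⟩
  · have := dvd_add (hQ.mul_left p) (hP.mul_right (Q : PowerSeries ℝ))
    rw [Polynomial.coe_mul]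
    convert this using 1
    ring
  · have h1 := hf.isBigO_one.mul hQO
    have h2 := hPO.mul ((Q.continuous.tendsto 0).isBigO_one ℝ)
    simp only [one_mul, mul_one] at h1 h2
    refine (h1.add h2).congr_left fun x => ?_
    rw [Polynomial.eval_mul]
    ring

theorem HasExpansion.pow {f : ℝ → ℝ} {p : PowerSeries ℝ} (hf : HasExpansion f p) (j : ℕ) :
    HasExpansion (fun x => f x ^ j) (p ^ j) := by
  induction j with
  | zero => simpa using hasExpansion_polynomial 1
  | succ j ih => simpa [pow_succ] using ih.mul hf

theorem HasExpansion.sub_sum {f F : ℝ → ℝ} {p q : PowerSeries ℝ} (hf : HasExpansion f p)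
    (hF : HasExpansion F q) (e : ℕ → ℝ) (N : ℕ) :
    HasExpansion (fun x => f x - ∑ j ∈ Finset.range N, e j * F x ^ j)
      (p - ∑ j ∈ Finset.range N, PowerSeries.C (e j) * q ^ j) := by
  induction N with
  | zero => simpa using hf
  | succ N ih =>
    have h1 := (hasExpansion_polynomial (Polynomial.C (e N))).mul (hF.pow N)
    have h2 := ih.sub h1
    simp only [Finset.sum_range_succ, ← sub_sub]
    simpa using h2

theorem X_pow_dvd_of_isBigO {P : Polynomial ℝ} {M : ℕ}
    (h : (fun x => P.eval x) =O[𝓝 0] fun x : ℝ => x ^ M) : Polynomial.X ^ M ∣ P := by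
  induction M with
  | zero => simp
  | succ M ih =>
    have h1 : (fun x : ℝ => x ^ (M + 1)) =O[𝓝 0] fun x : ℝ => x ^ M := by
      simpa [pow_succ] using (isBigO_refl (fun x : ℝ => x ^ M) (𝓝 0)).mul
        ((continuous_id.tendsto (0 : ℝ)).isBigO_one ℝ)
    obtain ⟨R, rfl⟩ := ih (h.trans h1)
    have h2 : (fun x => R.eval x) =O[𝓝[≠] 0] fun x : ℝ => x := by
      have h3 := (isBigO_refl (fun x : ℝ => (x ^ M)⁻¹) (𝓝[≠] 0)).mul (h.mono nhdsWithin_le_nhds)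
      refine h3.congr' ?_ ?_
      · filter_upwards [self_mem_nhdsWithin] with x hx
        have : x ≠ 0 := hx
        simp [this]
      · filter_upwards [self_mem_nhdsWithin] with x hx
        have : x ≠ 0 := hx
        field_simp
        ring
    have h4 : Tendsto (fun x => R.eval x) (𝓝[≠] 0) (𝓝 0) :=
      h2.trans_tendsto (tendsto_id.mono_left nhdsWithin_le_nhds)
    have h5 : Tendsto (fun x => R.eval x) (𝓝[≠] 0) (𝓝 (R.eval 0)) :=
      (R.continuous.tendsto 0).mono_left nhdsWithin_le_nhds
    have h6 : Polynomial.X ∣ R := by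
      rw [Polynomial.X_dvd_iff, Polynomial.coeff_zero_eq_eval_zero]
      exact tendsto_nhds_unique h5 h4
    rw [pow_succ]
    exact mul_dvd_mul_left _ h6

/-- The order of vanishing of a function bounds that of its expansion from below. -/
theorem HasExpansion.X_pow_dvd {f : ℝ → ℝ} {p : PowerSeries ℝ} (hf : HasExpansion f p) {M : ℕ}
    (h : f =O[𝓝 0] fun x : ℝ => x ^ M) : (PowerSeries.X : PowerSeries ℝ) ^ M ∣ p := by
  obtain ⟨P, hP, hPO⟩ := hf M
  have h1 : (fun x => P.eval x) =O[𝓝 0] fun x : ℝ => x ^ M :=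
    (h.sub hPO).congr_left fun x => by ring
  obtain ⟨R, rfl⟩ := X_pow_dvd_of_isBigO h1
  have h2 : (PowerSeries.X : PowerSeries ℝ) ^ M ∣ ((Polynomial.X ^ M * R : Polynomial ℝ) :
      PowerSeries ℝ) := by
    rw [Polynomial.coe_mul, Polynomial.coe_pow, Polynomial.coe_X]
    exact dvd_mul_right _ _
  simpa using dvd_add hP h2

theorem HasExpansion.unique {f : ℝ → ℝ} {p q : PowerSeries ℝ} (hp : HasExpansion f p)
    (hq : HasExpansion f q) : p = q := by
  ext n
  have h1 : (PowerSeries.X : PowerSeries ℝ) ^ (n + 1) ∣ p - q :=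
    (hp.sub hq).X_pow_dvd (by simpa using isBigO_zero _ _)
  have h2 := PowerSeries.X_pow_dvd_iff.1 h1 n (by omega)
  rwa [map_sub, sub_eq_zero] at h2

end Expansions

/-! ### Small orbits and their periods -/

section Flow

open Filter MeasureTheory

/-- Uniqueness of the solution of the initial value problem. -/
theorem IsSolution.eq_of_eq_zero {I : Set ℝ} {g : ℝ → ℝ}
    (hg : AnalyticOnNhd ℝ g I) {γ δ : ℝ → ℝ × ℝ} (hγ : IsSolution I g γ) (hδ : IsSolution I g δ)
    (h0 : γ 0 = δ 0) : γ = δ := by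
  have hcγ : Continuous γ := continuous_iff_continuousAt.2 fun t => (hγ t).2.continuousAt
  have hcδ : Continuous δ := continuous_iff_continuousAt.2 fun t => (hδ t).2.continuousAt
  -- the set of times where the two curves agree is open and closed
  have hclopen : IsClopen {t | γ t = δ t} := by
    refine ⟨isClosed_eq hcγ hcδ, isOpen_iff_mem_nhds.2 fun t ht => ?_⟩
    have hC : ContDiffAt ℝ 1 (fun p : ℝ × ℝ => (p.2, -g p.1)) (γ t) := by
      have h1 : ContDiffAt ℝ 1 g (γ t).1 := (hg _ (hγ t).1).contDiffAt
      exact contDiffAt_snd.prodMk (h1.comp (γ t) contDiffAt_fst).neg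
    obtain ⟨K, s, hs, hL⟩ := hC.exists_lipschitzOnWith
    have hs' : s ∈ 𝓝 (δ t) := by rwa [← show γ t = δ t from ht]
    exact ODE_solution_unique_of_eventually (v := fun _ p => (p.2, -g p.1)) (s := fun _ => s)
      (Eventually.of_forall fun _ => hL)
      ((hcγ.continuousAt.eventually hs).mono fun r hr => ⟨(hγ r).2, hr⟩)
      ((hcδ.continuousAt.eventually hs').mono fun r hr => ⟨(hδ r).2, hr⟩) ht
  funext t
  have := hclopen.eq_univ ⟨0, h0⟩
  exact this.ge (Set.mem_univ t)

theorem IsMinimalPeriod.unique {γ : ℝ → ℝ × ℝ} {S T : ℝ} (hS : IsMinimalPeriod γ S)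
    (hT : IsMinimalPeriod γ T) : S = T := by
  rcases lt_trichotomy S T with h | h | h
  · exact absurd hS.2.1 (hT.2.2 S hS.1 h)
  · exact h
  · exact absurd hT.2.1 (hS.2.2 T hT.1 h)

/-- The scalar equation `θ' = 1 / k(θ)` with a `2π`-periodic `k`: its solution is the inverse
function of `∫ k`, and it advances by `2π` in the time `∫₀^{2π} k`. -/
theorem exists_angle {k : ℝ → ℝ} (hk : Continuous k) (hper : Function.Periodic k (2 * Real.pi))
    (hlow : ∀ φ, 1 / 2 ≤ k φ) : ∃ θ : ℝ → ℝ, θ 0 = 0 ∧ StrictMono θ ∧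
      (∀ t, HasDerivAt θ (k (θ t))⁻¹ t) ∧
      ∀ t, θ (t + ∫ φ in (0 : ℝ)..2 * Real.pi, k φ) = θ t + 2 * Real.pi := by
  let τ : ℝ → ℝ := fun θ => ∫ φ in (0 : ℝ)..θ, k φ
  have hτ : ∀ θ, HasDerivAt τ (k θ) θ := fun θ => hk.integral_hasStrictDerivAt 0 θ |>.hasDerivAt
  have hpos : ∀ θ, 0 < k θ := fun θ => lt_of_lt_of_le (by norm_num) (hlow θ)
  have hmono : StrictMono τ := strictMono_of_hasDerivAt_pos hτ hpos
  have hcont : Continuous τ := continuous_iff_continuousAt.2 fun t => (hτ t).continuousAt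
  have hτ0 : τ 0 = 0 := intervalIntegral.integral_same
  have hmono2 : Monotone fun θ => τ θ - θ / 2 := by
    refine monotone_of_hasDerivAt_nonneg
      (f' := fun θ => k θ - 1 / 2) (fun θ => ?_) fun θ => sub_nonneg.2 (hlow θ)
    exact (hτ θ).sub ((hasDerivAt_id θ).div_const 2)
  have hsurj : Function.Surjective τ := by
    refine hcont.surjective ?_ ?_
    · refine tendsto_atTop_mono' atTop (f₁ := fun θ => θ / 2) ?_
        (tendsto_id.atTop_div_const (two_pos (α := ℝ)))
      filter_upwards [eventually_ge_atTop 0] with θ hθ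
      have := hmono2 hθ
      simp only [hτ0] at this
      linarith
    · refine tendsto_atBot_mono' atBot (f₁ := fun θ => θ / 2) ?_
        (tendsto_id.atBot_div_const (two_pos (α := ℝ)))
      filter_upwards [eventually_le_atBot 0] with θ hθ
      have := hmono2 hθ
      simp only [hτ0] at this
      linarith
  let Θ := hmono.orderIsoOfSurjective τ hsurj
  have hΘ : ∀ t, τ (Θ.symm t) = t := fun t => Θ.apply_symm_apply t
  have hΘ' : ∀ θ, Θ.symm (τ θ) = θ := fun θ => Θ.symm_apply_apply θ
  refine ⟨Θ.symm, ?_, Θ.symm.strictMono, fun t => ?_, fun t => ?_⟩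
  · have := hΘ' 0
    rwa [hτ0] at this
  · exact (hτ (Θ.symm t)).of_local_left_inverse Θ.symm.continuous.continuousAt (hpos _).ne'
      (Eventually.of_forall hΘ)
  · have h1 : τ (Θ.symm t + 2 * Real.pi) = t + ∫ φ in (0 : ℝ)..2 * Real.pi, k φ := by
      have h2 := intervalIntegral.integral_add_adjacent_intervals
        (hk.intervalIntegrable (μ := volume) 0 (Θ.symm t))
        (hk.intervalIntegrable (μ := volume) (Θ.symm t) (Θ.symm t + 2 * Real.pi))
      have h3 := hper.intervalIntegral_add_eq (Θ.symm t) 0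
      rw [zero_add] at h3
      rw [h3] at h2
      have h4 : (∫ φ in (0 : ℝ)..Θ.symm t, k φ) = t := hΘ t
      rw [h4] at h2
      exact h2.symm
    rw [← h1, hΘ']

/-- If `x = h(u)` satisfies `g(h(u)) h'(u) = u`, that is `G(h(u)) = u²/2`, for `|u| ≤ |A|`, then the
orbit through `(0, A)` is `(h(A sin θ), A cos θ)` with `θ' = 1 / h'(A sin θ)`, and its minimal
period is `∫₀^{2π} h'(A sin φ) dφ`. -/
theorem exists_isSolution_isMinimalPeriod {I : Set ℝ} {g h h' : ℝ → ℝ} {A : ℝ} (hA : A ≠ 0)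
    (h0 : h 0 = 0)
    (hI : ∀ u, |u| ≤ |A| → h u ∈ I) (hd : ∀ u, |u| ≤ |A| → HasDerivAt h (h' u) u)
    (hc : ContinuousOn h' {u | |u| ≤ |A|}) (hlow : ∀ u, |u| ≤ |A| → 1 / 2 ≤ h' u)
    (hgh : ∀ u, |u| ≤ |A| → g (h u) * h' u = u) :
    ∃ γ, IsSolution I g γ ∧ γ 0 = (0, A) ∧
      IsMinimalPeriod γ (∫ φ in (0 : ℝ)..2 * Real.pi, h' (A * Real.sin φ)) := by
  have hu : ∀ φ, |A * Real.sin φ| ≤ |A| := fun φ => by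
    rw [abs_mul]
    exact mul_le_of_le_one_right (abs_nonneg A) (Real.abs_sin_le_one φ)
  have hk : Continuous fun φ => h' (A * Real.sin φ) :=
    hc.comp_continuous (by fun_prop) hu
  have hper : Function.Periodic (fun φ => h' (A * Real.sin φ)) (2 * Real.pi) := fun φ => by
    simp only [Real.sin_add_two_pi]
  obtain ⟨θ, hθ0, hθm, hθd, hθp⟩ := exists_angle hk hper fun φ => hlow _ (hu φ)
  set T := ∫ φ in (0 : ℝ)..2 * Real.pi, h' (A * Real.sin φ) with hT
  have hθT : θ T = 2 * Real.pi := by simpa [hθ0] using hθp 0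
  have hTpos : 0 < T := by
    rw [← hθm.lt_iff_lt, hθ0, hθT]
    exact Real.two_pi_pos
  refine ⟨fun t => (h (A * Real.sin (θ t)), A * Real.cos (θ t)), fun t => ⟨hI _ (hu _), ?_⟩,
    by simp [hθ0, h0], hTpos, fun t => ?_, fun s hs hsT hsper => ?_⟩
  · have hne : h' (A * Real.sin (θ t)) ≠ 0 :=
      (lt_of_lt_of_le (by norm_num) (hlow _ (hu (θ t)))).ne'
    have h1 : HasDerivAt (fun t => A * Real.sin (θ t))
        (A * (Real.cos (θ t) * (h' (A * Real.sin (θ t)))⁻¹)) t :=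
      ((Real.hasDerivAt_sin _).comp t (hθd t)).const_mul A
    have h2 : HasDerivAt (fun t => A * Real.cos (θ t))
        (A * (-Real.sin (θ t) * (h' (A * Real.sin (θ t)))⁻¹)) t :=
      ((Real.hasDerivAt_cos _).comp t (hθd t)).const_mul A
    have h3 := (hd _ (hu (θ t))).comp t h1
    refine (h3.prodMk h2).congr_deriv ?_
    have h4 := hgh _ (hu (θ t))
    refine Prod.ext ?_ ?_
    · simp only
      field_simp
    · simp only
      field_simp
      linarith
  · simp only [hθp, Real.sin_add_two_pi, Real.cos_add_two_pi]
  · have h1 := congrArg Prod.snd (hsper 0)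
    simp only [zero_add, hθ0, Real.cos_zero, mul_one] at h1
    have h2 : Real.cos (θ s) = 1 := by
      rwa [mul_eq_left₀ hA] at h1
    have h3 : 0 < θ s := hθ0 ▸ hθm hs
    have h4 : θ s < 2 * Real.pi := hθT ▸ hθm hsT
    exact h3.ne' ((Real.cos_eq_one_iff_of_lt_of_lt (by linarith) h4).1 h2)

/-- The period of small orbits of an isochronous center, as an integral over the angle. -/
theorem IsIsochronousCenter.exists_integral_eq {I : Set ℝ} {g h : ℝ → ℝ} (hI : IsOpen I)
    (hg : AnalyticOnNhd ℝ g I) (h0I : (0 : ℝ) ∈ I) (hiso : IsIsochronousCenter I g)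
    (hh : AnalyticAt ℝ h 0) (h0 : h 0 = 0) (hd0 : deriv h 0 = 1)
    (hgh : ∀ᶠ u in 𝓝 (0 : ℝ), g (h u) * deriv h u = u) :
    ∃ T : ℝ, ∀ᶠ A in 𝓝[≠] (0 : ℝ),
      ∫ φ in (0 : ℝ)..2 * Real.pi, deriv h (A * Real.sin φ) = T := by
  obtain ⟨T, hT⟩ := hiso
  refine ⟨T, ?_⟩
  have hev : ∀ᶠ u in 𝓝 (0 : ℝ), AnalyticAt ℝ h u ∧ h u ∈ I ∧ 1 / 2 ≤ deriv h u ∧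
      g (h u) * deriv h u = u := by
    refine hh.eventually_analyticAt.and (Filter.Eventually.and ?_ (Filter.Eventually.and ?_ hgh))
    · exact hh.continuousAt.eventually (by rw [h0]; exact hI.mem_nhds h0I)
    · exact (hh.deriv.continuousAt.eventually (lt_mem_nhds (by rw [hd0]; norm_num))).mono
        fun u hu => le_of_lt hu
  obtain ⟨ε, hε, hball⟩ := Metric.eventually_nhds_iff_ball.1 hev
  have hin : Tendsto (fun A : ℝ => ((0 : ℝ), A)) (𝓝[≠] 0) (𝓝[≠] (0 : ℝ × ℝ)) := by
    refine tendsto_nhdsWithin_iff.2 ⟨?_, ?_⟩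
    · have : Continuous fun A : ℝ => ((0 : ℝ), A) := by fun_prop
      exact (this.tendsto 0).mono_left nhdsWithin_le_nhds
    · filter_upwards [self_mem_nhdsWithin] with A hA
      intro h1
      exact hA (congrArg Prod.snd h1)
  filter_upwards [hin.eventually hT, self_mem_nhdsWithin,
    nhdsWithin_le_nhds (Metric.ball_mem_nhds (0 : ℝ) hε)] with A hA hA0 hAε
  obtain ⟨γ, hγ, hγ0, hγT⟩ := hA
  have hsub : ∀ u, |u| ≤ |A| → u ∈ Metric.ball (0 : ℝ) ε := fun u hu => by
    rw [mem_ball_zero_iff, Real.norm_eq_abs] at hAε ⊢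
    exact hu.trans_lt hAε
  -- by uniqueness the given orbit through `(0, A)` is the explicit one, so the periods agree
  obtain ⟨δ, hδ, hδ0, hδT⟩ := exists_isSolution_isMinimalPeriod (I := I) (g := g) hA0 h0
    (fun u hu => (hball u (hsub u hu)).2.1)
    (fun u hu => (hball u (hsub u hu)).1.differentiableAt.hasDerivAt)
    (fun u hu => (hball u (hsub u hu)).1.deriv.continuousAt.continuousWithinAt)
    (fun u hu => (hball u (hsub u hu)).2.2.1) (fun u hu => (hball u (hsub u hu)).2.2.2)
  have heq : γ = δ := hγ.eq_of_eq_zero hg hδ (hγ0.trans hδ0.symm)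
  subst heq
  exact hδT.unique hγT

end Flow

/-! ### Averages over circles -/

section EvenPart

open Filter MeasureTheory

theorem integral_sin_pow_even_pos (j : ℕ) :
    0 < ∫ φ in (0 : ℝ)..2 * Real.pi, Real.sin φ ^ (2 * j) := by
  have hc : Continuous fun φ => Real.sin φ ^ (2 * j) := by fun_prop
  rw [← intervalIntegral.integral_add_adjacent_intervals
    (hc.intervalIntegrable (μ := volume) 0 Real.pi)
    (hc.intervalIntegrable (μ := volume) Real.pi (2 * Real.pi))]
  have h1 : 0 < ∫ φ in (0 : ℝ)..Real.pi, Real.sin φ ^ (2 * j) := integral_sin_pow_pos _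
  have h2 : 0 ≤ ∫ φ in Real.pi..2 * Real.pi, Real.sin φ ^ (2 * j) :=
    intervalIntegral.integral_nonneg (by linarith [Real.pi_pos]) fun φ _ =>
      (even_two_mul j).pow_nonneg _
  linarith

/-- Averaging a power series over the circle, term by term. -/
theorem IsPowerSum.integral_sin {f : ℝ → ℝ} {c : ℕ → ℝ} (hf : IsPowerSum f c) :
    IsPowerSum (fun A => ∫ φ in (0 : ℝ)..2 * Real.pi, f (A * Real.sin φ))
      (fun n => c n * ∫ φ in (0 : ℝ)..2 * Real.pi, Real.sin φ ^ n) := by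
  obtain ⟨ε, hε, hball⟩ := Metric.eventually_nhds_iff_ball.1 hf
  filter_upwards [Metric.ball_mem_nhds (0 : ℝ) hε] with A hA
  have hsin : ∀ φ, A * Real.sin φ ∈ Metric.ball (0 : ℝ) ε := fun φ => by
    rw [mem_ball_zero_iff, Real.norm_eq_abs] at hA ⊢
    rw [abs_mul]
    exact (mul_le_of_le_one_right (abs_nonneg A) (Real.abs_sin_le_one φ)).trans_lt hA
  have h1 := intervalIntegral.hasSum_integral_of_dominated_convergence (μ := volume) (a := 0)
    (b := 2 * Real.pi) (F := fun n φ => c n * (A * Real.sin φ) ^ n)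
    (f := fun φ => f (A * Real.sin φ)) (fun n _ => |c n * A ^ n|)
    (fun n => Continuous.aestronglyMeasurable (by fun_prop))
    (fun n => Eventually.of_forall fun φ _ => ?_)
    (Eventually.of_forall fun φ _ => (hball A hA).summable.abs)
    (by simp)
    (Eventually.of_forall fun φ _ => hball _ (hsin φ))
  · refine Eq.subst (motive := fun b => HasSum b _) (funext fun n => ?_) h1
    rw [mul_right_comm, ← intervalIntegral.integral_const_mul]
    congr 1
    funext φ
    rw [mul_pow]
    ring
  · rw [Real.norm_eq_abs, mul_pow, ← mul_assoc, abs_mul]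
    refine mul_le_of_le_one_right (abs_nonneg _) ?_
    rw [abs_pow]
    exact pow_le_one₀ (abs_nonneg _) (Real.abs_sin_le_one φ)

/-- If the integral of `f(A sin φ)` over the circle does not depend on `A`, then the even part of
`f` is constant. -/
theorem IsPowerSum.coeff_even_eq_zero {f : ℝ → ℝ} {c : ℕ → ℝ} (hf : IsPowerSum f c) {T : ℝ}
    (hT : ∀ᶠ A in 𝓝[≠] (0 : ℝ), ∫ φ in (0 : ℝ)..2 * Real.pi, f (A * Real.sin φ) = T) {j : ℕ}
    (hj : 1 ≤ j) : c (2 * j) = 0 := by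
  have h1 := hf.integral_sin
  have h2 : (fun A => ∫ φ in (0 : ℝ)..2 * Real.pi, f (A * Real.sin φ)) =ᶠ[𝓝 0]
      fun x => T * x ^ 0 := by
    have h3 : AnalyticAt ℝ (fun x : ℝ => T * x ^ 0) 0 := by fun_prop
    refine (h1.analyticAt.frequently_eq_iff_eventually_eq h3).1 (Eventually.frequently ?_)
    filter_upwards [hT] with A hA
    simpa using hA
  have h4 := congrFun ((h1.congr h2).unique (isPowerSum_single T 0)) (2 * j)
  rw [Pi.single_eq_of_ne (by omega)] at h4
  exact (mul_eq_zero.1 h4).resolve_right (integral_sin_pow_even_pos j).ne'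

end EvenPart

/-! ### The potential and the coordinate `s` -/

section Potential

open Filter MeasureTheory

variable {I : Set ℝ} {g : ℝ → ℝ} {a : ℕ → ℝ}

theorem IsAnalyticForce.isPowerSum (hg : IsAnalyticForce I g a) : IsPowerSum g a := hg.hasSum

theorem IsAnalyticForce.hasDerivAt_potential (hg : IsAnalyticForce I g a) {x : ℝ} (hx : x ∈ I) :
    HasDerivAt (potential g) (g x) x := by
  have hc : ContinuousOn g I := hg.analytic.continuousOn
  have hsub : Set.uIcc 0 x ⊆ I := hg.ordConnected.uIcc_subset hg.zero_mem hx
  exact intervalIntegral.integral_hasDerivAt_right (hc.mono hsub).intervalIntegrable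
    (hc.stronglyMeasurableAtFilter hg.isOpen x hx) (hc.continuousAt (hg.isOpen.mem_nhds hx))

theorem potential_zero (g : ℝ → ℝ) : potential g 0 = 0 := intervalIntegral.integral_same

theorem IsAnalyticForce.isPowerSum_potential (hg : IsAnalyticForce I g a) :
    IsPowerSum (potential g) (fun n => if n = 0 then 0 else a (n - 1) / n) :=
  hg.isPowerSum.antideriv
    (eventually_of_mem (hg.isOpen.mem_nhds hg.zero_mem) fun _ hx => hg.hasDerivAt_potential hx)
    (potential_zero g)

/-- The power series `Q` with `2G(x) = x² Q(x)`. -/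
noncomputable def potentialQuotient (a : ℕ → ℝ) : PowerSeries ℝ :=
  PowerSeries.mk fun n => 2 * a (n + 1) / (n + 2)

theorem IsAnalyticForce.exists_quotient (hg : IsAnalyticForce I g a) :
    ∃ q : ℝ → ℝ, IsPowerSum q (fun n => 2 * a (n + 1) / (n + 2)) ∧
      ∀ᶠ x in 𝓝 (0 : ℝ), 2 * potential g x = x ^ 2 * q x := by
  obtain ⟨q, hq, hFq⟩ := (hg.isPowerSum_potential.const_mul 2).exists_div_sq (by simp)
    (by simp [hg.coeff_zero])
  refine ⟨q, ?_, hFq⟩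
  convert hq using 2 with n
  rw [if_neg (by omega), show n + 2 - 1 = n + 1 by omega]
  push_cast
  ring

theorem IsAnalyticForce.hasExpansion_potential (hg : IsAnalyticForce I g a) :
    HasExpansion (fun x => 2 * potential g x) (PowerSeries.X ^ 2 * potentialQuotient a) := by
  obtain ⟨q, hq, hFq⟩ := hg.exists_quotient
  have h1 := (hasExpansion_polynomial (Polynomial.X ^ 2)).mul hq.hasExpansion
  rw [Polynomial.coe_pow, Polynomial.coe_X] at h1
  refine h1.congr ?_
  filter_upwards [hFq] with x hx
  rw [hx]
  simp

/-- The coordinate `s` with `G = s²/2`, and its inverse `h`; both are analytic. -/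
theorem IsAnalyticForce.exists_coordinate (hg : IsAnalyticForce I g a) :
    ∃ s h : ℝ → ℝ, AnalyticAt ℝ s 0 ∧ AnalyticAt ℝ h 0 ∧ s 0 = 0 ∧ h 0 = 0 ∧ deriv h 0 = 1 ∧
      (∀ᶠ x in 𝓝 (0 : ℝ), 2 * potential g x = s x ^ 2) ∧
      (∀ᶠ x in 𝓝 (0 : ℝ), h (s x) = x) ∧
      ∀ᶠ u in 𝓝 (0 : ℝ), g (h u) * deriv h u = u := by
  obtain ⟨q, hq, hFq⟩ := hg.exists_quotient
  have hq0 : q 0 = 1 := by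
    rw [hq.apply_zero]
    norm_num [hg.coeff_one]
  have hsqrt : AnalyticAt ℝ (fun x => √(q x)) 0 := by
    have := (hq.analyticAt.contDiffAt (n := ⊤)).sqrt (by rw [hq0]; exact one_ne_zero)
    exact this.analyticAt
  let s : ℝ → ℝ := fun x => x * √(q x)
  have hs : AnalyticAt ℝ s 0 := analyticAt_id.mul hsqrt
  have hs0 : s 0 = 0 := by simp [s]
  have hds : deriv s 0 = 1 := by
    have h1 := (hasDerivAt_id (0 : ℝ)).mul hsqrt.differentiableAt.hasDerivAt
    have h2 : HasDerivAt s 1 0 := h1.congr_deriv (by simp [hq0])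
    exact h2.deriv
  have hds' : deriv s 0 ≠ 0 := by rw [hds]; exact one_ne_zero
  have hsF : ∀ᶠ x in 𝓝 (0 : ℝ), 2 * potential g x = s x ^ 2 := by
    have hpos : ∀ᶠ x in 𝓝 (0 : ℝ), 0 < q x :=
      hq.analyticAt.continuousAt.eventually (lt_mem_nhds (by rw [hq0]; exact one_pos))
    filter_upwards [hFq, hpos] with x hx hx'
    rw [hx, mul_pow, Real.sq_sqrt hx'.le]
  have hstrict := hs.hasStrictDerivAt
  let h := hstrict.localInverse s (deriv s 0) 0 hds'
  have hh : AnalyticAt ℝ h 0 := by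
    have := hs.analyticAt_localInverse hds'
    rwa [hs0] at this
  have hleft : ∀ᶠ x in 𝓝 (0 : ℝ), h (s x) = x := hstrict.eventually_left_inverse hds'
  have hright : ∀ᶠ u in 𝓝 (0 : ℝ), s (h u) = u := by
    have := hstrict.eventually_right_inverse hds'
    rwa [hs0] at this
  have hh0 : h 0 = 0 := by
    have := hleft.self_of_nhds
    rwa [hs0] at this
  have hdh : deriv h 0 = 1 := by
    have := (hstrict.to_localInverse hds').hasDerivAt.deriv
    rw [hs0] at this
    rw [← inv_one, ← hds]
    exact this
  refine ⟨s, h, hs, hh, hs0, hh0, hdh, hsF, hleft, ?_⟩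
  have hto : Tendsto h (𝓝 0) (𝓝 0) := by
    have := hh.continuousAt.tendsto
    rwa [hh0] at this
  have hFh : ∀ᶠ u in 𝓝 (0 : ℝ), 2 * potential g (h u) = u ^ 2 := by
    filter_upwards [hto.eventually hsF, hright] with u h1 h2
    rw [h1, h2]
  filter_upwards [hFh.eventually_nhds, hh.eventually_analyticAt,
    hto.eventually (hg.isOpen.mem_nhds hg.zero_mem)] with u h1 h2 h3
  have h4 := ((hg.hasDerivAt_potential h3).comp u h2.differentiableAt.hasDerivAt).const_mul 2
  have h5 : HasDerivAt (fun v : ℝ => v ^ 2) (2 * u) u := by simpa using hasDerivAt_pow 2 u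
  have h6 := (h4.congr_of_eventuallyEq (EventuallyEq.symm h1)).unique h5
  linarith

theorem sum_range_eq_of_odd_eq_zero {c : ℕ → ℝ} (h1 : c 1 = 1)
    (hodd : ∀ j, 1 ≤ j → c (2 * j + 1) = 0) (u : ℝ) (M : ℕ) :
    ∑ n ∈ Finset.range (2 * (M + 1)), c n * u ^ n =
      u + ∑ j ∈ Finset.range (M + 1), c (2 * j) * (u ^ 2) ^ j := by
  induction M with
  | zero => simp [Finset.sum_range_succ, h1, add_comm]
  | succ M ih =>
    rw [show 2 * (M + 1 + 1) = 2 * (M + 1) + 1 + 1 by ring, Finset.sum_range_succ,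
      Finset.sum_range_succ, ih, hodd (M + 1) (by omega), Finset.sum_range_succ _ (M + 1),
      ← pow_mul]
    ring

/-- For an isochronous potential the inverse `h` of the coordinate `s` is `u` plus an even function,
so that `x - s(x)` is a function of `s(x)² = 2G(x)`. -/
theorem IsIsochronousCenter.exists_formalRelation (hiso : IsIsochronousCenter I g)
    (hg : IsAnalyticForce I g a) : ∃ W e, FormalRelation (potentialQuotient a) W e := by
  obtain ⟨s, h, hs, hh, hs0, hh0, hdh, hsF, hleft, hgh⟩ := hg.exists_coordinate
  obtain ⟨T, hT⟩ := hiso.exists_integral_eq hg.isOpen hg.analytic hg.zero_mem hh hh0 hdh hgh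
  obtain ⟨d, hd⟩ := exists_isPowerSum hh.deriv
  have hd0 : d 0 = 1 := by rw [← hd.apply_zero, hdh]
  have heven : ∀ j, 1 ≤ j → d (2 * j) = 0 := fun j hj => hd.coeff_even_eq_zero hT hj
  have hc := hd.antideriv (hh.eventually_analyticAt.mono
    fun u hu => hu.differentiableAt.hasDerivAt) hh0
  set c : ℕ → ℝ := fun n => if n = 0 then 0 else d (n - 1) / n with hcdef
  have hc1 : c 1 = 1 := by simp [hcdef, hd0]
  have hodd : ∀ j, 1 ≤ j → c (2 * j + 1) = 0 := fun j hj => by simp [hcdef, heven j hj]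
  obtain ⟨w, hw⟩ := exists_isPowerSum (analyticAt_id.fun_sub hs)
  have hW := hw.hasExpansion
  have hF := hg.hasExpansion_potential
  refine ⟨PowerSeries.mk w, fun j => c (2 * j), ?_, by simp [hcdef], fun N => ?_, ?_⟩
  · rw [potentialQuotient, PowerSeries.coeff_mk]
    norm_num [hg.coeff_one]
  · rcases N with _ | M
    · simp
    refine (hW.sub_sum hF (fun j => c (2 * j)) (M + 1)).X_pow_dvd ?_
    have hto : Tendsto s (𝓝 0) (𝓝 0) := by
      have := hs.continuousAt.tendsto
      rwa [hs0] at this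
    -- the expansion of `h` with `u = s(x)` substituted
    have h1 := (hc.isBigO (2 * (M + 1))).comp_tendsto hto
    have h2 : s =O[𝓝 0] fun x : ℝ => x := by
      have := hs.differentiableAt.isBigO_sub
      simpa [hs0] using this
    refine (h1.trans (h2.pow _)).congr' ?_ EventuallyEq.rfl
    filter_upwards [hsF, hleft] with x hx hx'
    simp only [Function.comp_apply, id_eq]
    rw [sum_range_eq_of_odd_eq_zero hc1 hodd, hx', hx]
    ring
  · have h1 := ((hasExpansion_polynomial Polynomial.X).sub hW).pow 2
    rw [Polynomial.coe_X] at h1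
    refine hF.unique (h1.congr ?_)
    filter_upwards [hsF] with x hx
    rw [hx]
    simp

theorem IsAnalyticForce.potential_eq_of_potentialQuotient_eq_one (hg : IsAnalyticForce I g a)
    (hQ : potentialQuotient a = 1) {x : ℝ} (hx : x ∈ I) : potential g x = x ^ 2 / 2 := by
  have ha : a = Pi.single 1 1 := by
    funext n
    rcases n with _ | _ | n
    · rw [hg.coeff_zero, Pi.single_eq_of_ne (by omega)]
    · rw [zero_add, hg.coeff_one, Pi.single_eq_same]
    · have h1 := congrArg (PowerSeries.coeff (n + 1)) hQ
      rw [potentialQuotient, PowerSeries.coeff_mk, PowerSeries.coeff_one, if_neg (by omega)] at h1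
      rw [Pi.single_eq_of_ne (by omega)]
      have h2 : ((n + 1 : ℕ) : ℝ) + 2 ≠ 0 := by positivity
      rw [div_eq_zero_iff, or_iff_left h2] at h1
      linarith
  have hloc : g =ᶠ[𝓝 0] fun x => 1 * x ^ 1 := by
    have h1 := hg.isPowerSum
    rw [ha] at h1
    filter_upwards [h1, isPowerSum_single 1 1] with x hx hx'
    exact hx.unique hx'
  have hid : AnalyticOnNhd ℝ (fun x : ℝ => 1 * x ^ 1) I := fun x _ => by fun_prop
  have hEq : Set.EqOn g (fun x => 1 * x ^ 1) I :=
    hg.analytic.eqOn_of_preconnected_of_eventuallyEq hid hg.ordConnected.isPreconnected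
      hg.zero_mem hloc
  have hsub : Set.uIcc 0 x ⊆ I := hg.ordConnected.uIcc_subset hg.zero_mem hx
  rw [potential, intervalIntegral.integral_congr (hEq.mono hsub)]
  simp

theorem IsAnalyticForce.eventually_mem_symmetricDomain (hg : IsAnalyticForce I g a) :
    ∀ᶠ x in 𝓝 (0 : ℝ), x ∈ symmetricDomain I := by
  have h0 : Tendsto (fun x : ℝ => -x) (𝓝 0) (𝓝 0) := by
    simpa using (continuous_neg (G := ℝ)).tendsto 0
  exact Filter.Eventually.and (hg.isOpen.mem_nhds hg.zero_mem)
    (h0.eventually (hg.isOpen.mem_nhds hg.zero_mem))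

theorem IsAnalyticForce.coeff_of_evenTerm_eq_zero (hg : IsAnalyticForce I g a)
    (h : ∀ x ∈ symmetricDomain I, evenTerm g x = 0) {k : ℕ} (hk : 1 ≤ k) : a (2 * k + 1) = 0 := by
  have h1 := hg.isPowerSum_potential.add hg.isPowerSum_potential.comp_neg
  have h2 : (fun x => potential g x + potential g (-x)) =ᶠ[𝓝 0] fun x => 1 * x ^ 2 := by
    filter_upwards [hg.eventually_mem_symmetricDomain] with x hx
    have := h x hx
    rw [evenTerm] at this
    linarith
  have h3 := congrFun ((h1.congr h2).unique (isPowerSum_single 1 2)) (2 * k + 2)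
  rw [Pi.single_eq_of_ne (by omega), if_neg (by omega), Even.neg_one_pow ⟨k + 1, by ring⟩,
    show 2 * k + 2 - 1 = 2 * k + 1 by omega] at h3
  have h4 : ((2 * k + 2 : ℕ) : ℝ) ≠ 0 := by positivity
  have h5 : a (2 * k + 1) / ((2 * k + 2 : ℕ) : ℝ) = 0 := by linarith
  exact (div_eq_zero_iff.1 h5).resolve_right h4

theorem IsAnalyticForce.coeff_of_oddTerm_eq_zero (hg : IsAnalyticForce I g a)
    (h : ∀ x ∈ symmetricDomain I, oddTerm g x = 0) (k : ℕ) : a (2 * k) = 0 := by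
  have h1 := hg.isPowerSum_potential.add (hg.isPowerSum_potential.comp_neg.const_mul (-1))
  have h2 : (fun x => potential g x + -1 * potential g (-x)) =ᶠ[𝓝 0] fun x => 0 * x ^ 0 := by
    filter_upwards [hg.eventually_mem_symmetricDomain] with x hx
    have := h x hx
    rw [oddTerm] at this
    linarith
  have h3 := congrFun ((h1.congr h2).unique (isPowerSum_single 0 0)) (2 * k + 1)
  rw [Pi.single_zero, if_neg (by omega), Odd.neg_one_pow ⟨k, rfl⟩,
    show 2 * k + 1 - 1 = 2 * k by omega, Pi.zero_apply] at h3
  have h4 : ((2 * k + 1 : ℕ) : ℝ) ≠ 0 := by positivity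
  have h5 : a (2 * k) / ((2 * k + 1 : ℕ) : ℝ) = 0 := by linarith
  exact (div_eq_zero_iff.1 h5).resolve_right h4

/-! ### Conclusions for isochronous potentials -/

theorem coeff_potentialQuotient_odd (a : ℕ → ℝ) (j : ℕ) :
    PowerSeries.coeff (2 * j + 1) (potentialQuotient a) = 2 / (2 * j + 3) * a (2 * (j + 1)) := by
  rw [potentialQuotient, PowerSeries.coeff_mk, show 2 * j + 1 + 1 = 2 * (j + 1) by ring]
  push_cast
  ring

theorem coeff_potentialQuotient_even (a : ℕ → ℝ) (k : ℕ) :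
    PowerSeries.coeff (2 * k) (potentialQuotient a) = a (2 * k + 1) / (k + 1) := by
  rw [potentialQuotient, PowerSeries.coeff_mk]
  have h1 : (k : ℝ) + 1 ≠ 0 := by positivity
  push_cast
  field_simp

/-- Both `x^{2m+1}` and `x^{4m}` detect the first nonzero coefficient `e_m` of `E`, so a potential
whose nonquadratic terms of one parity all vanish is harmonic. -/
theorem IsIsochronousCenter.potential_eq (hiso : IsIsochronousCenter I g)
    (hg : IsAnalyticForce I g a)
    (h : (∀ k, 1 ≤ k → a (2 * k + 1) = 0) ∨ ∀ k, a (2 * k) = 0) :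
    ∀ x ∈ I, potential g x = x ^ 2 / 2 := by
  obtain ⟨W, e, hrel⟩ := hiso.exists_formalRelation hg
  have he : ∀ i, e i = 0 := by
    intro i
    induction i using Nat.strong_induction_on with
    | _ m ih =>
      rcases Nat.eq_zero_or_pos m with rfl | hm
      · exact hrel.e_zero
      obtain ⟨h1, h2⟩ := hrel.coeff_of_forall_lt hm ih
      rcases h with h | h
      · rw [show 4 * m - 2 = 2 * (2 * m - 1) by omega, coeff_potentialQuotient_even,
          h _ (by omega), zero_div] at h2
        have h3 : (4 * (m : ℝ) + 1) ≠ 0 := by positivity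
        exact pow_eq_zero_iff two_ne_zero |>.1 ((mul_eq_zero.1 h2.symm).resolve_left h3)
      · rw [show 2 * m - 1 = 2 * (m - 1) + 1 by omega, coeff_potentialQuotient_odd, h,
          mul_zero] at h1
        linarith
  exact fun x hx => hg.potential_eq_of_potentialQuotient_eq_one
    (hrel.eq_one_of_forall_eq_zero he) hx

theorem IsIsochronousCenter.coeff_three (hiso : IsIsochronousCenter I g)
    (hg : IsAnalyticForce I g a) : a 3 = 10 / 9 * a 2 ^ 2 := by
  obtain ⟨W, e, hrel⟩ := hiso.exists_formalRelation hg
  obtain ⟨h1, h2⟩ := hrel.coeff_of_forall_lt le_rfl fun i hi => by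
    rw [Nat.lt_one_iff.1 hi, hrel.e_zero]
  have h3 := coeff_potentialQuotient_odd a 0
  have h4 := coeff_potentialQuotient_even a 1
  norm_num at h1 h2 h3 h4
  rw [h3] at h1
  rw [h4] at h2
  have h5 : e 1 = -(a 2) / 3 := by linarith
  rw [h5] at h2
  linarith

theorem exists_universal_coeff_polynomial (k : ℕ) : ∃ P : MvPolynomial (Fin k) ℚ,
    ∀ (I : Set ℝ) (g : ℝ → ℝ) (a : ℕ → ℝ), IsAnalyticForce I g a → IsIsochronousCenter I g →
      a (2 * k + 1) = MvPolynomial.aeval (fun i : Fin k => a (2 * ((i : ℕ) + 1))) P := by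
  obtain ⟨P, hP⟩ := exists_universal_polynomial k
  -- rescale the variables and the value to pass from the coefficients of `Q` to those of `g`
  refine ⟨MvPolynomial.C ((k : ℚ) + 1) * MvPolynomial.bind₁
    (fun i : Fin k => MvPolynomial.C (2 / (2 * (i : ℚ) + 3)) * MvPolynomial.X i) P,
    fun I g a hg hiso => ?_⟩
  obtain ⟨W, e, hrel⟩ := hiso.exists_formalRelation hg
  have h1 := hP _ W e hrel
  rw [coeff_potentialQuotient_even] at h1
  simp only [coeff_potentialQuotient_odd] at h1
  have h2 : (k : ℝ) + 1 ≠ 0 := by positivity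
  rw [div_eq_iff h2] at h1
  rw [h1, map_mul, MvPolynomial.aeval_bind₁]
  simp only [map_mul, MvPolynomial.aeval_C, MvPolynomial.aeval_X]
  simp [mul_comm]

end Potential

end Isochronous

theorem theoremC :
    -- each odd coefficient is a universal rational polynomial in the preceding even ones
    (∀ k : ℕ, 1 ≤ k → ∃ P : MvPolynomial (Fin k) ℚ,
      ∀ (I : Set ℝ) (g : ℝ → ℝ) (a : ℕ → ℝ),
        Isochronous.IsAnalyticForce I g a → Isochronous.IsIsochronousCenter I g →
          a (2 * k + 1) = MvPolynomial.aeval (fun i : Fin k => a (2 * ((i : ℕ) + 1))) P) ∧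
    (∀ (I : Set ℝ) (g : ℝ → ℝ) (a : ℕ → ℝ),
      Isochronous.IsAnalyticForce I g a → Isochronous.IsIsochronousCenter I g →
        a 3 = 10 / 9 * a 2 ^ 2 ∧
        ((∀ x ∈ Isochronous.symmetricDomain I, Isochronous.evenTerm g x = 0) ↔
          (∀ x ∈ Isochronous.symmetricDomain I, Isochronous.oddTerm g x = 0)) ∧
        ((∀ x ∈ Isochronous.symmetricDomain I, Isochronous.evenTerm g x = 0) ↔
          (∀ x ∈ I, Isochronous.potential g x = x ^ 2 / 2))) := by
  refine ⟨fun k _ => Isochronous.exists_universal_coeff_polynomial k, fun I g a hg hiso => ?_⟩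
  have heven : (∀ x ∈ Isochronous.symmetricDomain I, Isochronous.evenTerm g x = 0) ↔
      ∀ x ∈ I, Isochronous.potential g x = x ^ 2 / 2 := by
    refine ⟨fun h => hiso.potential_eq hg (Or.inl fun k hk => hg.coeff_of_evenTerm_eq_zero h hk),
      fun h x hx => ?_⟩
    rw [Isochronous.evenTerm, h x hx.1, h (-x) hx.2]
    ring
  have hodd : (∀ x ∈ Isochronous.symmetricDomain I, Isochronous.oddTerm g x = 0) ↔
      ∀ x ∈ I, Isochronous.potential g x = x ^ 2 / 2 := by
    refine ⟨fun h => hiso.potential_eq hg (Or.inr fun k => hg.coeff_of_oddTerm_eq_zero h k),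
      fun h x hx => ?_⟩
    rw [Isochronous.oddTerm, h x hx.1, h (-x) hx.2]
    ring
  exact ⟨hiso.coeff_three hg, heven.trans hodd.symm, heven⟩
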